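/- There are universal constants $C,c>0$ such that for every integer $n\ge 1$ there is a non-empty set $S\subset\{-1,1\}^n$ with the following two properties. (i) For all $\sigma\ne\sigma'$ in $S$, $|\sigma\cdot\sigma'|\le C\,n^{2/3}$, where $\sigma\cdot\sigma'=\sum_{i=1}^n\sigma_i\sigma_i'$. (ii) Let $X_1,\dots,X_n$ be independent standard normal random variables on a probability space, let $f(\sigma)=\sum_{i=1}^n X_i\sigma_i$ for $\sigma\in\{-1,1\}^n$, and let $M_S=\max_{\sigma\in S}f(\sigma)$. Then $M_S$ is integrable and $$\mathbb{P}\bigl(|M_S-\mathbb{E}[M_S]|\ge t\bigr)\le 6\,e^{-ct/n^{1/3}},\qquad t\ge 0.$$ -/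

import Mathlib

open MeasureTheory ProbabilityTheory

/-- Sign vectors: the elements of `{-1, 1}ⁿ` (the units of `ℤ` are exactly `-1` and `1`). -/
abbrev SignVec (n : ℕ) : Type := Fin n → ℤˣ

/-- The overlap `σ · σ' = ∑ i, σ i * σ' i` of two sign vectors. -/
def overlap {n : ℕ} (σ τ : SignVec n) : ℤ := ∑ i, (σ i : ℤ) * (τ i : ℤ)

/-- The field `f(σ) = ∑ i, X i * σ i` on `{-1, 1}ⁿ`, built from the random variables `X i`. -/
def signField {n : ℕ} {Ω : Type*} (X : Fin n → Ω → ℝ) (σ : SignVec n) (ω : Ω) : ℝ :=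
  ∑ i, X i ω * ((σ i : ℤ) : ℝ)

/-- The maximum `max_{σ ∈ S} f(σ)` of the field over a non-empty set `S` of sign vectors. -/
def maxField {n : ℕ} {Ω : Type*} (X : Fin n → Ω → ℝ) (S : Finset (SignVec n))
    (hS : S.Nonempty) (ω : Ω) : ℝ :=
  S.sup' hS (fun σ => signField X σ ω)

open scoped ENNReal NNReal

/-! ### The Prékopa–Leindler inequality -/

/-! Put `s = n^(1/3)` and `a = √s / 3`. Each `f(σ) / √n` is a standard Gaussian, and overlaps of
size at most `s² / 2` give correlations at most `1 / (2s)`, of order `a⁻²`. At height `a` such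
correlations are harmless: they raise the probability that two of these Gaussians both lie in `[a, a
+ 1/a]` by at most a constant factor over independence. A Gilbert–Varshamov argument provides about
`exp (s / 8)` sign vectors with such overlaps, which leaves room for a set `S` of about `a * exp (a²
/ 2)` of them, the number at which the maximum sits near `√n * a`.

For this `S` the union bound gives an exponential upper tail above `√n * a` at scale `√n / a = 3s`,
the required order `n^(1/3)` (`measureReal_le_maxField_le`). The second moment method gives only
that the maximum exceeds `√n * a` with probability at least a constant `δ`
(`exists_le_measureReal_le_maxField`).

Convexity turns this weak lower bound into a lower tail. The maximum is a convex function of the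
Gaussian vector, so by Prékopa–Leindler its distribution function is midpoint log-concave. That
function is at most `1 - δ` at `√n * a` and close to `1` a constant multiple of `s` higher;
log-concavity propagates this relative drop, so it decays geometrically below
(`exists_measureReal_le_abs_sub_le`). Finally the centre `√n * a` is replaced by the mean. -/

lemma Real.volume_preimage_two_mul_sub (b : ℝ) (K : Set ℝ) :
    2 * volume ((fun z : ℝ => 2 * z - b) ⁻¹' K) = volume K := by
  have h1 : (fun z : ℝ => 2 * z - b) ⁻¹' K
      = (fun z : ℝ => 2 * z) ⁻¹' ((fun z : ℝ => z + (-b)) ⁻¹' K) := by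
    ext z; simp [sub_eq_add_neg]
  rw [h1, Real.volume_preimage_mul_left (two_ne_zero), measure_preimage_add_right, ← mul_assoc,
    show (2 : ℝ≥0∞) = ENNReal.ofReal 2 by simp, ← ENNReal.ofReal_mul (by norm_num)]
  norm_num

/-- The one-dimensional Brunn–Minkowski inequality for midpoints, compact case. -/
lemma IsCompact.volume_add_volume_le_two_mul {K L C : Set ℝ} (hK : IsCompact K) (hL : IsCompact L)
    (hK0 : K.Nonempty) (hL0 : L.Nonempty) (hC : ∀ x ∈ K, ∀ y ∈ L, (x + y) / 2 ∈ C) :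
    volume K + volume L ≤ 2 * volume C := by
  obtain ⟨p, hpK, hp⟩ := hK.exists_isGreatest hK0
  obtain ⟨q, hqL, hq⟩ := hL.exists_isLeast hL0
  -- `A = (K + q) / 2` and `B = (p + L) / 2`, with `p = max K` and `q = min L`, both lie in `C` and
  -- meet at most at `(p + q) / 2`.
  set A := (fun z : ℝ => 2 * z - q) ⁻¹' K
  set B := (fun z : ℝ => 2 * z - p) ⁻¹' L
  have hBm : MeasurableSet B := hL.measurableSet.preimage (by fun_prop)
  have hsub : A ∪ B ⊆ C := by
    rintro z (hz | hz)
    · have := hC _ hz q hqL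
      simpa using this
    · have := hC p hpK _ hz
      simpa using this
  have hdisj : AEDisjoint volume A B := by
    refine measure_mono_null (t := {(p + q) / 2}) ?_ (by simp)
    rintro z ⟨hzA, hzB⟩
    have h1 := hp hzA
    have h2 := hq hzB
    simp only [Set.mem_singleton_iff] at *
    linarith
  calc volume K + volume L = 2 * (volume A + volume B) := by
        rw [mul_add, Real.volume_preimage_two_mul_sub, Real.volume_preimage_two_mul_sub]
    _ = 2 * volume (A ∪ B) := by rw [measure_union₀ hBm.nullMeasurableSet hdisj]
    _ ≤ 2 * volume C := by gcongr

/-- The one-dimensional Brunn–Minkowski inequality for midpoints. -/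
lemma MeasurableSet.volume_add_volume_le_two_mul {A B C : Set ℝ} (hA : MeasurableSet A)
    (hB : MeasurableSet B) (hA0 : A.Nonempty) (hB0 : B.Nonempty)
    (hC : ∀ x ∈ A, ∀ y ∈ B, (x + y) / 2 ∈ C) :
    volume A + volume B ≤ 2 * volume C := by
  obtain ⟨x₀, hx₀⟩ := hA0
  obtain ⟨y₀, hy₀⟩ := hB0
  rw [hA.measure_eq_iSup_isCompact, hB.measure_eq_iSup_isCompact]
  simp_rw [iSup_and']
  refine ENNReal.biSup_add_biSup_le' ⟨∅, by simp⟩ ⟨∅, by simp⟩ fun K hK' L hL' => ?_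
  obtain ⟨hKA, hK⟩ := hK'
  obtain ⟨hLB, hL⟩ := hL'
  -- The inner approximations may be empty; adding one point of each set restores nonemptiness.
  have := (hK.insert x₀).volume_add_volume_le_two_mul (hL.insert y₀) (C := C)
    (Set.insert_nonempty _ _) (Set.insert_nonempty _ _)
    (fun x hx y hy => hC x (Set.insert_subset hx₀ hKA hx) y (Set.insert_subset hy₀ hLB hy))
  refine le_trans (add_le_add ?_ ?_) this
  · exact measure_mono (Set.subset_insert _ _)
  · exact measure_mono (Set.subset_insert _ _)

lemma ENNReal.four_mul_mul_le_add_sq (a b : ℝ≥0∞) : 4 * (a * b) ≤ (a + b) ^ 2 := by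
  wlog hab : a ≤ b generalizing a b
  · rw [mul_comm a, add_comm]; exact this b a (le_of_not_ge hab)
  obtain ⟨d, rfl⟩ := exists_add_of_le hab
  calc 4 * (a * (a + d)) ≤ 4 * (a * (a + d)) + d ^ 2 := le_self_add
    _ = _ := by ring

/-- Prékopa–Leindler inequality for midpoints, for functions with supremum one. -/
lemma lintegral_add_lintegral_le_two_mul {f g h : ℝ → ℝ} (hf : Measurable f) (hg : Measurable g)
    (hh : Measurable h) (hf0 : 0 ≤ f) (hg0 : 0 ≤ g) (hh0 : 0 ≤ h) (hf1 : ∀ x, f x ≤ 1)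
    (hg1 : ∀ x, g x ≤ 1) (hfs : ∀ c < 1, ∃ x, c < f x) (hgs : ∀ c < 1, ∃ x, c < g x)
    (hfg : ∀ x y, f x * g y ≤ h ((x + y) / 2) ^ 2) :
    (∫⁻ x, ENNReal.ofReal (f x)) + ∫⁻ x, ENNReal.ofReal (g x)
      ≤ 2 * ∫⁻ x, ENNReal.ofReal (h x) := by
  rw [lintegral_eq_lintegral_meas_lt _ (.of_forall hf0) hf.aemeasurable,
    lintegral_eq_lintegral_meas_lt _ (.of_forall hg0) hg.aemeasurable,
    lintegral_eq_lintegral_meas_lt _ (.of_forall hh0) hh.aemeasurable]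
  have hmeas : ∀ k : ℝ → ℝ, Measurable fun t : ℝ => volume {a | t < k a} := fun k =>
    Antitone.measurable fun s t hst => measure_mono fun a (ha : t < k a) => lt_of_le_of_lt hst ha
  rw [← lintegral_add_left (hmeas f), ← lintegral_const_mul _ (hmeas h)]
  -- Brunn–Minkowski is applied level by level. Below height `1` the superlevel sets of `f` and `g`
  -- are nonempty because both suprema are `1`; above it they are empty.
  refine setLIntegral_mono ((hmeas h).const_mul _) fun t (ht : 0 < t) => ?_
  rcases lt_or_ge t 1 with ht1 | ht1
  · refine MeasurableSet.volume_add_volume_le_two_mul (measurableSet_lt measurable_const hf)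
      (measurableSet_lt measurable_const hg) (hfs t ht1) (hgs t ht1) ?_
    intro x (hx : t < f x) y (hy : t < g y)
    have h1 : t ^ 2 < h ((x + y) / 2) ^ 2 := by
      refine lt_of_lt_of_le ?_ (hfg x y)
      nlinarith
    exact lt_of_pow_lt_pow_left₀ 2 (hh0 _) h1
  · have e1 : {a | t < f a} = ∅ := by
      ext a; simpa using (hf1 a).trans ht1
    have e2 : {a | t < g a} = ∅ := by
      ext a; simpa using (hg1 a).trans ht1
    simp [e1, e2]

/-- Prékopa–Leindler inequality for midpoints on the line, for bounded functions. -/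
lemma lintegral_mul_lintegral_le_sq {f g h : ℝ → ℝ} (hf : Measurable f) (hg : Measurable g)
    (hh : Measurable h) (hf0 : 0 ≤ f) (hg0 : 0 ≤ g) (hh0 : 0 ≤ h)
    (hfb : BddAbove (Set.range f)) (hgb : BddAbove (Set.range g))
    (hfg : ∀ x y, f x * g y ≤ h ((x + y) / 2) ^ 2) :
    (∫⁻ x, ENNReal.ofReal (f x)) * ∫⁻ x, ENNReal.ofReal (g x)
      ≤ (∫⁻ x, ENNReal.ofReal (h x)) ^ 2 := by
  set F := ⨆ x, f x
  set G := ⨆ x, g x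
  have hF : ∀ x, f x ≤ F := le_ciSup hfb
  have hG : ∀ x, g x ≤ G := le_ciSup hgb
  rcases ((hf0 0).trans (hF 0)).eq_or_lt with hF0 | hF0
  · have : ∀ x, f x = 0 := fun x => le_antisymm ((hF x).trans hF0.symm.le) (hf0 x)
    simp [this]
  rcases ((hg0 0).trans (hG 0)).eq_or_lt with hG0 | hG0
  · have : ∀ x, g x = 0 := fun x => le_antisymm ((hG x).trans hG0.symm.le) (hg0 x)
    simp [this]
  simp only [Pi.zero_apply] at hF0 hG0
  -- Dividing `f`, `g`, `h` by `F`, `G`, `√(F * G)` preserves the midpoint hypothesis and makes both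
  -- suprema `1`. The additive inequality then yields the multiplicative one by AM–GM.
  set R := √(F * G)
  have hR : 0 < R := Real.sqrt_pos.2 (mul_pos hF0 hG0)
  have hR2 : R ^ 2 = F * G := Real.sq_sqrt (mul_pos hF0 hG0).le
  have key := lintegral_add_lintegral_le_two_mul (f := fun x => F⁻¹ * f x)
    (g := fun x => G⁻¹ * g x) (h := fun x => R⁻¹ * h x) (hf.const_mul _) (hg.const_mul _)
    (hh.const_mul _) (fun x => mul_nonneg (inv_nonneg.2 hF0.le) (hf0 x))
    (fun x => mul_nonneg (inv_nonneg.2 hG0.le) (hg0 x))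
    (fun x => mul_nonneg (inv_nonneg.2 hR.le) (hh0 x))
    (fun x => by rw [inv_mul_le_one₀ hF0]; exact hF x)
    (fun x => by rw [inv_mul_le_one₀ hG0]; exact hG x)
    (fun c hc => by
      obtain ⟨x, hx⟩ := exists_lt_of_lt_ciSup (f := f) (b := c * F)
        (by change _ < F; nlinarith)
      exact ⟨x, by rw [lt_inv_mul_iff₀ hF0]; linarith⟩)
    (fun c hc => by
      obtain ⟨x, hx⟩ := exists_lt_of_lt_ciSup (f := g) (b := c * G)
        (by change _ < G; nlinarith)
      exact ⟨x, by rw [lt_inv_mul_iff₀ hG0]; linarith⟩)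
    (fun x y => by
      rw [mul_pow, inv_pow, hR2, mul_inv]
      calc F⁻¹ * f x * (G⁻¹ * g y) = F⁻¹ * G⁻¹ * (f x * g y) := by ring
        _ ≤ _ := by gcongr; exact hfg x y)
  simp_rw [ENNReal.ofReal_mul (inv_nonneg.2 hF0.le), ENNReal.ofReal_mul (inv_nonneg.2 hG0.le),
    ENNReal.ofReal_mul (inv_nonneg.2 hR.le)] at key
  rw [lintegral_const_mul _ (by fun_prop), lintegral_const_mul _ (by fun_prop),
    lintegral_const_mul _ (by fun_prop)] at key
  set a := ∫⁻ x, ENNReal.ofReal (f x)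
  set b := ∫⁻ x, ENNReal.ofReal (g x)
  set c := ∫⁻ x, ENNReal.ofReal (h x)
  have h4 := (ENNReal.four_mul_mul_le_add_sq _ _).trans (pow_le_pow_left' key 2)
  have e1 : 4 * (ENNReal.ofReal F⁻¹ * a * (ENNReal.ofReal G⁻¹ * b))
      = 4 * ENNReal.ofReal (F⁻¹ * G⁻¹) * (a * b) := by
    rw [ENNReal.ofReal_mul (inv_nonneg.2 hF0.le)]; ring
  have e2 : (2 * (ENNReal.ofReal R⁻¹ * c)) ^ 2 = 4 * ENNReal.ofReal (F⁻¹ * G⁻¹) * c ^ 2 := by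
    rw [← mul_inv, ← hR2, ← inv_pow, ENNReal.ofReal_pow (inv_nonneg.2 hR.le)]; ring
  rw [e1, e2] at h4
  refine (ENNReal.mul_le_mul_iff_right ?_ ?_).1 h4
  · simp [hF0, hG0]
  · exact ENNReal.mul_ne_top (by simp) ENNReal.ofReal_ne_top

/-- A measure for which the midpoint Prékopa–Leindler inequality holds, for functions with values
in `[0, 1]`. -/
def SatisfiesPrekopaLeindler {E : Type*} [AddCommGroup E] [Module ℝ E] [MeasurableSpace E]
    (μ : Measure E) : Prop :=
  ∀ f g h : E → ℝ≥0∞, Measurable f → Measurable g → Measurable h → (∀ x, f x ≤ 1) →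
    (∀ x, g x ≤ 1) → (∀ x, h x ≤ 1) →
    (∀ x y, f x * g y ≤ h ((2⁻¹ : ℝ) • (x + y)) ^ 2) →
    (∫⁻ x, f x ∂μ) * ∫⁻ x, g x ∂μ ≤ (∫⁻ x, h x ∂μ) ^ 2

/-! ### Prékopa–Leindler for Gaussian measures -/

lemma gaussianPDFReal_mul_le_sq (x y : ℝ) :
    gaussianPDFReal 0 1 x * gaussianPDFReal 0 1 y ≤ gaussianPDFReal 0 1 ((x + y) / 2) ^ 2 := by
  simp only [gaussianPDFReal, NNReal.coe_one, mul_one, sub_zero]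
  rw [mul_pow, ← Real.exp_nat_mul, mul_mul_mul_comm, ← Real.exp_add, ← sq]
  gcongr
  push_cast
  nlinarith [sq_nonneg (x - y)]

/-- The Gaussian density is log-concave, so it can be absorbed as a factor into each of the three
functions; being bounded, it keeps the products bounded as the Lebesgue version requires. -/
lemma satisfiesPrekopaLeindler_gaussianReal : SatisfiesPrekopaLeindler (gaussianReal 0 1) := by
  intro f g h hf hg hh hf1 hg1 hh1 hfg
  have hφ : Measurable (gaussianPDFReal 0 1) := measurable_gaussianPDFReal _ _
  have hφ0 := gaussianPDFReal_nonneg 0 1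
  have hφb : ∀ x, gaussianPDFReal 0 1 x ≤ (√(2 * Real.pi))⁻¹ := fun x => by
    simp only [gaussianPDFReal, NNReal.coe_one, mul_one, sub_zero]
    refine mul_le_of_le_one_right (by positivity) ?_
    rw [Real.exp_le_one_iff]
    nlinarith [sq_nonneg x]
  have hint : ∀ k : ℝ → ℝ≥0∞, Measurable k → (∀ x, k x ≤ 1) → ∫⁻ x, k x ∂(gaussianReal 0 1)
      = ∫⁻ x, ENNReal.ofReal (gaussianPDFReal 0 1 x * (k x).toReal) := by
    intro k hk hk1
    rw [gaussianReal_of_var_ne_zero _ one_ne_zero,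
      lintegral_withDensity_eq_lintegral_mul _ (measurable_gaussianPDF 0 1) hk]
    refine lintegral_congr fun x => ?_
    rw [ENNReal.ofReal_mul (hφ0 x), ENNReal.ofReal_toReal ((hk1 x).trans_lt ENNReal.one_lt_top).ne]
    rfl
  have hle1 : ∀ a : ℝ≥0∞, a ≤ 1 → a.toReal ≤ 1 := fun a ha => by
    simpa using ENNReal.toReal_mono ENNReal.one_ne_top ha
  have hbdd : ∀ k : ℝ → ℝ≥0∞, (∀ x, k x ≤ 1) →
      BddAbove (Set.range fun x => gaussianPDFReal 0 1 x * (k x).toReal) := by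
    rintro k hk1
    refine ⟨(√(2 * Real.pi))⁻¹, ?_⟩
    rintro _ ⟨x, rfl⟩
    exact (mul_le_of_le_one_right (hφ0 x) (hle1 _ (hk1 x))).trans (hφb x)
  rw [hint f hf hf1, hint g hg hg1, hint h hh hh1]
  refine lintegral_mul_lintegral_le_sq (hφ.mul hf.ennreal_toReal) (hφ.mul hg.ennreal_toReal)
    (hφ.mul hh.ennreal_toReal) (fun x => mul_nonneg (hφ0 x) ENNReal.toReal_nonneg)
    (fun x => mul_nonneg (hφ0 x) ENNReal.toReal_nonneg)
    (fun x => mul_nonneg (hφ0 x) ENNReal.toReal_nonneg) (hbdd f hf1) (hbdd g hg1) fun x y => ?_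
  rw [mul_pow, mul_mul_mul_comm]
  refine mul_le_mul (gaussianPDFReal_mul_le_sq x y) ?_ (by positivity) (by positivity)
  have := ENNReal.toReal_mono (ENNReal.pow_ne_top ((hh1 _).trans_lt ENNReal.one_lt_top).ne)
    (hfg x y)
  rw [ENNReal.toReal_mul, ENNReal.toReal_pow, smul_eq_mul] at this
  rwa [div_eq_inv_mul]

lemma lintegral_le_one_of_le_one {E : Type*} [MeasurableSpace E] (μ : Measure E)
    [IsProbabilityMeasure μ] {f : E → ℝ≥0∞} (hf : ∀ x, f x ≤ 1) : ∫⁻ x, f x ∂μ ≤ 1 :=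
  (lintegral_mono hf).trans (by simp)

/-- Tensorisation: the inequality for `ν` on fibres is exactly the midpoint hypothesis for the fibre
integrals, to which the inequality for `μ` applies. Fibre integrals stay in `[0, 1]` because `ν` is
a probability measure. -/
lemma SatisfiesPrekopaLeindler.prod {E F : Type*} [AddCommGroup E] [Module ℝ E]
    [MeasurableSpace E] [AddCommGroup F] [Module ℝ F] [MeasurableSpace F]
    {μ : Measure E} {ν : Measure F} [IsProbabilityMeasure μ] [IsProbabilityMeasure ν]
    (hμ : SatisfiesPrekopaLeindler μ) (hν : SatisfiesPrekopaLeindler ν) :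
    SatisfiesPrekopaLeindler (μ.prod ν) := by
  intro f g h hf hg hh hf1 hg1 hh1 hfg
  rw [lintegral_prod _ hf.aemeasurable, lintegral_prod _ hg.aemeasurable,
    lintegral_prod _ hh.aemeasurable]
  refine hμ _ _ _ hf.lintegral_prod_right' hg.lintegral_prod_right' hh.lintegral_prod_right'
    (fun x => lintegral_le_one_of_le_one ν fun y => hf1 _)
    (fun x => lintegral_le_one_of_le_one ν fun y => hg1 _)
    (fun x => lintegral_le_one_of_le_one ν fun y => hh1 _) fun x x' => ?_
  exact hν _ _ _ (hf.comp measurable_prodMk_left) (hg.comp measurable_prodMk_left)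
    (hh.comp measurable_prodMk_left) (fun _ => hf1 _) (fun _ => hg1 _) (fun _ => hh1 _)
    fun y y' => hfg (x, y) (x', y')

lemma SatisfiesPrekopaLeindler.of_measurePreserving {E F : Type*} [AddCommGroup E] [Module ℝ E]
    [MeasurableSpace E] [AddCommGroup F] [Module ℝ F] [MeasurableSpace F]
    {μ : Measure E} {ν : Measure F} (hμ : SatisfiesPrekopaLeindler μ) (e : E →ₗ[ℝ] F)
    (he : MeasurePreserving e μ ν) : SatisfiesPrekopaLeindler ν := by
  intro f g h hf hg hh hf1 hg1 hh1 hfg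
  rw [← he.lintegral_comp hf, ← he.lintegral_comp hg, ← he.lintegral_comp hh]
  refine hμ _ _ _ (hf.comp he.measurable) (hg.comp he.measurable) (hh.comp he.measurable)
    (fun _ => hf1 _) (fun _ => hg1 _) (fun _ => hh1 _) fun x y => ?_
  simpa using hfg (e x) (e y)

/-- The standard Gaussian measure on `ℝⁿ` satisfies the Prékopa–Leindler inequality. -/
lemma satisfiesPrekopaLeindler_pi_gaussianReal (n : ℕ) :
    SatisfiesPrekopaLeindler (Measure.pi fun _ : Fin n => gaussianReal 0 1) := by
  induction n with
  | zero =>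
    intro f g h _ _ _ _ _ _ hfg
    rw [Measure.pi_of_empty, lintegral_dirac, lintegral_dirac, lintegral_dirac]
    convert hfg _ _ using 3
  | succ n ih =>
    have he := (measurePreserving_piFinSuccAbove
      (fun _ : Fin (n + 1) => gaussianReal 0 1) 0).symm
    exact (satisfiesPrekopaLeindler_gaussianReal.prod ih).of_measurePreserving
      { toFun := (MeasurableEquiv.piFinSuccAbove (fun _ : Fin (n + 1) => ℝ) 0).symm
        map_add' := fun x y => by
          ext i; refine Fin.cases ?_ (fun j => ?_) i <;> simp [MeasurableEquiv.piFinSuccAbove]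
        map_smul' := fun c x => by
          ext i; refine Fin.cases ?_ (fun j => ?_) i <;> simp [MeasurableEquiv.piFinSuccAbove] } he

/-- The distribution function of a convex function under a Prékopa–Leindler measure is midpoint
log-concave. -/
lemma SatisfiesPrekopaLeindler.measureReal_lt_mul_le_sq {E : Type*} [AddCommGroup E] [Module ℝ E]
    [MeasurableSpace E] {μ : Measure E} [IsProbabilityMeasure μ] (hμ : SatisfiesPrekopaLeindler μ)
    {M : E → ℝ} (hM : Measurable M)
    (hconv : ∀ x y, M ((2⁻¹ : ℝ) • (x + y)) ≤ (M x + M y) / 2) (s t : ℝ) :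
    μ.real {x | M x < s} * μ.real {x | M x < t} ≤ μ.real {x | M x < (s + t) / 2} ^ 2 := by
  have hm : ∀ r, MeasurableSet {x | M x < r} := fun r => measurableSet_lt hM measurable_const
  have hle : ∀ r, ∀ x, ({x | M x < r}.indicator 1 x : ℝ≥0∞) ≤ 1 := fun r x =>
    Set.indicator_le_self' (by simp) x
  -- By convexity, midpoints of `{M < s}` and `{M < t}` lie in `{M < (s + t) / 2}`, so the three
  -- indicators satisfy the midpoint hypothesis.
  have := hμ ({x | M x < s}.indicator 1) ({x | M x < t}.indicator 1)
    ({x | M x < (s + t) / 2}.indicator 1) (measurable_one.indicator (hm _))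
    (measurable_one.indicator (hm _)) (measurable_one.indicator (hm _)) (hle _) (hle _) (hle _)
    (fun x y => by
      by_cases hx : M x < s
      · by_cases hy : M y < t
        · have : M ((2⁻¹ : ℝ) • (x + y)) < (s + t) / 2 := by linarith [hconv x y]
          rw [Set.indicator_of_mem (s := {x | M x < (s + t) / 2}) this]
          simpa using mul_le_mul' (hle s x) (hle t y)
        · simp [hy]
      · simp [hx])
  rw [lintegral_indicator_one (hm _), lintegral_indicator_one (hm _),
    lintegral_indicator_one (hm _)] at this
  have := ENNReal.toReal_mono (by finiteness) this
  rwa [ENNReal.toReal_mul, ENNReal.toReal_pow] at this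

/-! ### Nearly orthogonal sign vectors -/

/-- The sum factors over coordinates, each contributing `2 * cosh c ≤ 2 * exp (c² / 2)`. -/
lemma sum_exp_overlap_le {n : ℕ} (σ : SignVec n) (c : ℝ) :
    ∑ τ : SignVec n, Real.exp (c * overlap σ τ) ≤ 2 ^ n * Real.exp (n * (c ^ 2 / 2)) := by
  have h1 : ∀ τ : SignVec n, Real.exp (c * overlap σ τ)
      = ∏ i, Real.exp (c * ((σ i : ℤ) * (τ i : ℤ))) := fun τ => by
    rw [← Real.exp_sum, overlap]; push_cast; rw [Finset.mul_sum]
  have h2 : ∀ i, ∑ u : ℤˣ, Real.exp (c * ((σ i : ℤ) * (u : ℤ))) ≤ 2 * Real.exp (c ^ 2 / 2) := by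
    intro i
    have h3 : ∑ u : ℤˣ, Real.exp (c * ((σ i : ℤ) * (u : ℤ))) = 2 * Real.cosh c := by
      rw [Real.cosh_eq, show (Finset.univ : Finset ℤˣ) = {1, -1} from rfl,
        Finset.sum_pair (by decide)]
      rcases Int.units_eq_one_or (σ i) with h | h <;> rw [h] <;> push_cast <;> ring_nf
    rw [h3]
    gcongr
    exact Real.cosh_le_exp_half_sq c
  calc ∑ τ : SignVec n, Real.exp (c * overlap σ τ)
      = ∏ i, ∑ u : ℤˣ, Real.exp (c * ((σ i : ℤ) * (u : ℤ))) := by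
        rw [Finset.prod_univ_sum, Fintype.piFinset_univ]
        exact Finset.sum_congr rfl fun τ _ => h1 τ
    _ ≤ ∏ _i : Fin n, 2 * Real.exp (c ^ 2 / 2) :=
        Finset.prod_le_prod (fun _ _ => by positivity) fun i _ => h2 i
    _ = _ := by rw [Finset.prod_const, Finset.card_univ, Fintype.card_fin, mul_pow,
        ← Real.exp_nat_mul]

/-- Hoeffding's inequality for the number of sign vectors with a large overlap. -/
lemma card_lt_abs_overlap_le {n : ℕ} (hn : 1 ≤ n) (σ : SignVec n) {D : ℝ} (hD : 0 ≤ D) :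
    (({τ : SignVec n | D < |(overlap σ τ : ℝ)|} : Finset (SignVec n)).card : ℝ)
      ≤ 2 * (2 ^ n * Real.exp (-(D ^ 2 / (2 * n)))) := by
  have hn0 : (0 : ℝ) < n := by exact_mod_cast hn
  have hc : 0 ≤ D / n := by positivity
  -- Chernoff bound for both signs, with the parameter `c = D / n` that minimises `-c * D + n * c² /
  -- 2`.
  have h1 : ∀ τ : SignVec n, (if D < |(overlap σ τ : ℝ)| then (1 : ℝ) else 0)
      ≤ Real.exp (-(D ^ 2 / n)) *
        (Real.exp (D / n * overlap σ τ) + Real.exp (-(D / n) * overlap σ τ)) := by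
    intro τ
    split_ifs with h
    · rw [mul_add, ← Real.exp_add, ← Real.exp_add]
      rcases lt_abs.1 h with h | h
      · refine le_add_of_le_of_nonneg (Real.one_le_exp ?_) (Real.exp_nonneg _)
        have := mul_le_mul_of_nonneg_left h.le hc
        have e : D / n * D = D ^ 2 / n := by ring
        linarith
      · refine le_add_of_nonneg_of_le (Real.exp_nonneg _) (Real.one_le_exp ?_)
        have := mul_le_mul_of_nonneg_left h.le hc
        have e : D / n * D = D ^ 2 / n := by ring
        linarith
    · positivity
  rw [Finset.card_filter]
  push_cast
  refine (Finset.sum_le_sum fun τ _ => h1 τ).trans ?_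
  rw [← Finset.mul_sum, Finset.sum_add_distrib]
  have h2 := sum_exp_overlap_le σ (D / n)
  have h3 := sum_exp_overlap_le σ (-(D / n))
  rw [neg_sq] at h3
  calc _ ≤ Real.exp (-(D ^ 2 / n)) * (2 ^ n * Real.exp (n * ((D / n) ^ 2 / 2))
        + 2 ^ n * Real.exp (n * ((D / n) ^ 2 / 2))) := by gcongr
    _ = 2 * (2 ^ n * (Real.exp (-(D ^ 2 / n)) * Real.exp (n * ((D / n) ^ 2 / 2)))) := by ring
    _ = _ := by
      rw [← Real.exp_add]
      congr 4
      field_simp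
      ring

/-- A Gilbert–Varshamov bound for sign vectors with small overlaps. -/
lemma exists_overlap_le_and_two_pow_le {n : ℕ} (hn : 1 ≤ n) {D : ℝ} (hD : 0 ≤ D) :
    ∃ S : Finset (SignVec n), (∀ σ ∈ S, ∀ τ ∈ S, σ ≠ τ → |(overlap σ τ : ℝ)| ≤ D) ∧
      (2 : ℝ) ^ n ≤ S.card * (1 + 2 * (2 ^ n * Real.exp (-(D ^ 2 / (2 * n))))) := by
  classical
  -- A family of maximal cardinality cannot be extended, so every sign vector either belongs to it
  -- or has overlap above `D` with one of its members; counting this cover bounds `S.card` below.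
  obtain ⟨S, hS, hmax⟩ := Finset.exists_max_image
    ({S : Finset (SignVec n) | ∀ σ ∈ S, ∀ τ ∈ S, σ ≠ τ → |(overlap σ τ : ℝ)| ≤ D} :
      Finset (Finset (SignVec n))) Finset.card ⟨∅, by simp⟩
  simp only [Finset.mem_filter, Finset.mem_univ, true_and] at hS hmax
  refine ⟨S, hS, ?_⟩
  have hcomm : ∀ σ τ : SignVec n, overlap σ τ = overlap τ σ := fun σ τ => by
    simp [overlap, mul_comm]
  have hcover : (Finset.univ : Finset (SignVec n))
      ⊆ S.biUnion fun σ => 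
        ({σ} ∪ ({τ | D < |(overlap σ τ : ℝ)|} : Finset (SignVec n))) := by
    intro τ _
    by_contra hτ
    simp only [Finset.mem_biUnion, Finset.mem_union, Finset.mem_singleton, Finset.mem_filter,
      Finset.mem_univ, true_and, not_exists, not_and, not_or, not_lt] at hτ
    have hτS : τ ∉ S := fun h => (hτ τ h).1 rfl
    have := hmax (insert τ S) (by
      intro σ hσ σ' hσ' hne
      rcases Finset.mem_insert.1 hσ with rfl | hσS <;> rcases Finset.mem_insert.1 hσ' with rfl | hσS'
      · exact absurd rfl hne
      · rw [hcomm]; exact (hτ _ hσS').2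
      · exact (hτ _ hσS).2
      · exact hS _ hσS _ hσS' hne)
    rw [Finset.card_insert_of_notMem hτS] at this
    omega
  have h1 := Finset.card_le_card hcover
  have h2 : (Finset.univ : Finset (SignVec n)).card = 2 ^ n := by
    rw [Finset.card_univ, Fintype.card_fun, Fintype.card_fin]; rfl
  rw [h2] at h1
  have h3 : ((2 ^ n : ℕ) : ℝ)
      ≤ ∑ σ ∈ S, (1 + 2 * (2 ^ n * Real.exp (-(D ^ 2 / (2 * n))))) := by
    refine (Nat.cast_le.2 (h1.trans Finset.card_biUnion_le)).trans ?_
    push_cast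
    refine Finset.sum_le_sum fun σ _ => ?_
    refine (Nat.cast_le.2 (Finset.card_union_le _ _)).trans ?_
    push_cast
    rw [Finset.card_singleton, Nat.cast_one]
    gcongr
    exact card_lt_abs_overlap_le hn σ hD
  rw [Finset.sum_const, nsmul_eq_mul] at h3
  exact_mod_cast h3

/-- Sets of sign vectors with overlaps at most `n ^ (2 / 3) / 2` and prescribed cardinality. -/
lemma exists_card_eq_and_overlap_le {n : ℕ} (hn : 1 ≤ n) {x y : ℝ} (hx : 0 ≤ x)
    (hx3 : x ^ 3 = n) (hyx : y ≤ Real.exp (x / 8) / 4) :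
    ∃ S : Finset (SignVec n), S.card = ⌈y⌉₊ ∧
      ∀ σ ∈ S, ∀ τ ∈ S, σ ≠ τ → |(overlap σ τ : ℝ)| ≤ x ^ 2 / 2 := by
  obtain ⟨S, hS, hcard⟩ := exists_overlap_le_and_two_pow_le hn (D := x ^ 2 / 2) (by positivity)
  have hn1 : (1 : ℝ) ≤ n := by exact_mod_cast hn
  have hxpos : 0 < x := by
    rcases hx.eq_or_lt with h | h
    · rw [← h] at hx3; norm_num at hx3; linarith
    · exact h
  have hexp : (x ^ 2 / 2) ^ 2 / (2 * n) = x / 8 := by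
    rw [← hx3]; field_simp; norm_num
  rw [hexp] at hcard
  have hxn : x ≤ n := by
    by_contra! h
    have : 1 < x := lt_of_le_of_lt hn1 h
    nlinarith [mul_pos hxpos hxpos, mul_pos (sub_pos.2 this) hxpos]
  have h2n : Real.exp (x / 8) ≤ 2 ^ n := by
    rw [← Real.rpow_natCast, Real.rpow_def_of_pos two_pos]
    have := Real.log_two_gt_d9
    gcongr
    nlinarith
  have hE := Real.exp_pos (x / 8)
  have h4 : Real.exp (x / 8) / 4 ≤ S.card := by
    rw [Real.exp_neg] at hcard
    -- Since `exp (x / 8) ≤ 2 ^ n`, the summand `1` from the vector itself is absorbed.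
    have h5 : (1 + 2 * (2 ^ n * (Real.exp (x / 8))⁻¹)) ≤ 3 * 2 ^ n * (Real.exp (x / 8))⁻¹ := by
      have : 1 ≤ 2 ^ n * (Real.exp (x / 8))⁻¹ := by
        rw [← div_eq_mul_inv, one_le_div hE]; exact h2n
      linarith
    have h6 : (2 : ℝ) ^ n ≤ S.card * (3 * 2 ^ n * (Real.exp (x / 8))⁻¹) :=
      hcard.trans (by gcongr)
    have h7 : (2 : ℝ) ^ n * Real.exp (x / 8) ≤ 2 ^ n * (S.card * 3) := by
      calc (2 : ℝ) ^ n * Real.exp (x / 8)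
          ≤ S.card * (3 * 2 ^ n * (Real.exp (x / 8))⁻¹) * Real.exp (x / 8) := by gcongr
        _ = _ := by field_simp
    have := le_of_mul_le_mul_left h7 (by positivity)
    linarith
  -- The family is cut down to an exact size: the union bound needs it not too large, the second
  -- moment not too small.
  obtain ⟨T, hTS, hT⟩ := Finset.exists_subset_card_eq (Nat.ceil_le.2 (hyx.trans h4))
  exact ⟨T, hT, fun σ hσ τ hτ => hS σ (hTS hσ) τ (hTS hτ)⟩

/-! ### Linear functionals of a standard Gaussian vector -/

lemma hasGaussianLaw_eval_pi_gaussianReal (n : ℕ) :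
    HasGaussianLaw (fun (x : Fin n → ℝ) i => x i) (Measure.pi fun _ : Fin n => gaussianReal 0 1) :=
  iIndepFun.hasGaussianLaw (X := fun i (x : Fin n → ℝ) => x i)
    (fun i => (measurePreserving_eval (fun _ : Fin n => gaussianReal 0 1) i).hasLaw.hasGaussianLaw)
    (iIndepFun_pi (X := fun _ => id) fun _ => aemeasurable_id)

lemma memLp_eval_pi_gaussianReal {n : ℕ} (i : Fin n) :
    MemLp (fun x : Fin n → ℝ => x i) 2 (Measure.pi fun _ : Fin n => gaussianReal 0 1) :=
  ((hasGaussianLaw_eval_pi_gaussianReal n).eval i).memLp_two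

/-- The linear functional `x ↦ ∑ i, x i * w i`. -/
def linearFunctional {n : ℕ} (w : Fin n → ℝ) : (Fin n → ℝ) →L[ℝ] ℝ :=
  ∑ i, w i • ContinuousLinearMap.proj (R := ℝ) (φ := fun _ : Fin n => ℝ) i

lemma linearFunctional_apply {n : ℕ} (w x : Fin n → ℝ) :
    linearFunctional w x = ∑ i, w i * x i := by
  simp [linearFunctional]

lemma covariance_linearFunctional {n : ℕ} (w v : Fin n → ℝ) :
    cov[linearFunctional w, linearFunctional v; Measure.pi fun _ : Fin n => gaussianReal 0 1]
      = ∑ i, w i * v i := by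
  have hind : iIndepFun (fun i (x : Fin n → ℝ) => x i)
      (Measure.pi fun _ : Fin n => gaussianReal 0 1) :=
    iIndepFun_pi (X := fun _ => id) fun _ => aemeasurable_id
  have hcov : ∀ i j, cov[fun x : Fin n → ℝ => x i, fun x => x j;
      Measure.pi fun _ : Fin n => gaussianReal 0 1] = if i = j then 1 else 0 := by
    intro i j
    split_ifs with h
    · subst h
      have hl := (measurePreserving_eval (fun _ : Fin n => gaussianReal 0 1) i).hasLaw
      rw [covariance_self (measurable_pi_apply i).aemeasurable]
      exact hl.variance_eq.trans (by simp)
    · exact (hind.indepFun h).covariance_eq_zero (memLp_eval_pi_gaussianReal i)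
        (memLp_eval_pi_gaussianReal j)
  have e : ∀ u : Fin n → ℝ, (linearFunctional u : (Fin n → ℝ) → ℝ)
      = fun x => ∑ i, u i * x i := fun u => funext fun x => linearFunctional_apply u x
  rw [e, e, covariance_fun_sum_fun_sum (fun i => (memLp_eval_pi_gaussianReal i).const_mul _)
    (fun i => (memLp_eval_pi_gaussianReal i).const_mul _)]
  simp_rw [covariance_const_mul_left, covariance_const_mul_right, hcov]
  simp

lemma hasLaw_linearFunctional {n : ℕ} (w : Fin n → ℝ) :
    HasLaw (linearFunctional w) (gaussianReal 0 (∑ i, w i ^ 2).toNNReal)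
      (Measure.pi fun _ : Fin n => gaussianReal 0 1) where
  map_eq := by
    have h := (hasGaussianLaw_eval_pi_gaussianReal n).map_fun (linearFunctional w)
    have h' : HasGaussianLaw (linearFunctional w) (Measure.pi fun _ : Fin n => gaussianReal 0 1) := h
    rw [h'.map_eq_gaussianReal, ← covariance_self h'.aemeasurable, covariance_linearFunctional]
    congr 1
    · have e : (linearFunctional w : (Fin n → ℝ) → ℝ) = fun x => ∑ i, w i * x i :=
        funext fun x => linearFunctional_apply w x
      rw [e, integral_finsetSum _ fun i _ =>
        ((memLp_eval_pi_gaussianReal i).integrable one_le_two).const_mul _]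
      refine Finset.sum_eq_zero fun i _ => ?_
      have hl := (measurePreserving_eval (fun _ : Fin n => gaussianReal 0 1) i).hasLaw
      have h0 : ∫ x : Fin n → ℝ, x i ∂(Measure.pi fun _ : Fin n => gaussianReal 0 1) = 0 :=
        hl.integral_eq.trans integral_id_gaussianReal
      rw [integral_const_mul, h0, mul_zero]
    · simp_rw [sq]

/-- The two functionals are jointly Gaussian, so vanishing covariance suffices. -/
lemma indepFun_linearFunctional {n : ℕ} {w v : Fin n → ℝ} (h : ∑ i, w i * v i = 0) :
    IndepFun (linearFunctional w) (linearFunctional v)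
      (Measure.pi fun _ : Fin n => gaussianReal 0 1) := by
  refine HasGaussianLaw.indepFun_of_covariance_eq_zero ?_
    ((covariance_linearFunctional w v).trans h)
  exact (hasGaussianLaw_eval_pi_gaussianReal n).map_fun
    ((linearFunctional w).prod (linearFunctional v))

/-! ### Estimates for the Gaussian density -/

lemma gaussianReal_le_of_gaussianPDFReal_le {v : ℝ≥0} (hv : v ≠ 0) {s : Set ℝ}
    (hs : MeasurableSet s) {B : ℝ} (hB : ∀ x ∈ s, gaussianPDFReal 0 v x ≤ B) :
    gaussianReal 0 v s ≤ ENNReal.ofReal B * volume s := by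
  rw [gaussianReal_apply _ hv, ← setLIntegral_const]
  exact setLIntegral_mono' hs fun x hx => ENNReal.ofReal_le_ofReal (hB x hx)

lemma le_gaussianReal_of_le_gaussianPDFReal {v : ℝ≥0} (hv : v ≠ 0) {s : Set ℝ}
    (hs : MeasurableSet s) {B : ℝ} (hB : ∀ x ∈ s, B ≤ gaussianPDFReal 0 v x) :
    ENNReal.ofReal B * volume s ≤ gaussianReal 0 v s := by
  rw [gaussianReal_apply _ hv, ← setLIntegral_const]
  exact setLIntegral_mono' hs fun x hx => ENNReal.ofReal_le_ofReal (hB x hx)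

/-- Mass of the window `[a, a + 1 / a]`. -/
lemma le_gaussianReal_real_Icc {a : ℝ} (ha : 0 < a) :
    (√(2 * Real.pi))⁻¹ * Real.exp (-((a + a⁻¹) ^ 2 / 2)) * a⁻¹
      ≤ (gaussianReal 0 1).real (Set.Icc a (a + a⁻¹)) := by
  have h := le_gaussianReal_of_le_gaussianPDFReal (one_ne_zero (α := ℝ≥0))
    (measurableSet_Icc (a := a) (b := a + a⁻¹))
    (B := (√(2 * Real.pi))⁻¹ * Real.exp (-((a + a⁻¹) ^ 2 / 2))) fun x hx => by
      simp only [gaussianPDFReal, NNReal.coe_one, mul_one, sub_zero, neg_div]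
      have hx0 : 0 ≤ x := ha.le.trans hx.1
      have := hx.2
      gcongr
  rw [Real.volume_Icc, add_sub_cancel_left, ← ENNReal.ofReal_mul (by positivity)] at h
  exact (ENNReal.ofReal_le_iff_le_toReal (by finiteness)).1 h

/-- The tangent bound `-x² / 2 ≤ a² / 2 - a * x` replaces the density by an exponential, which
integrates exactly. -/
lemma gaussianReal_real_Ici_le {a u : ℝ} (ha : 0 < a) :
    (gaussianReal 0 1).real (Set.Ici (a + u))
      ≤ (√(2 * Real.pi))⁻¹ * Real.exp (-(a ^ 2 / 2)) * a⁻¹ * Real.exp (-(a * u)) := by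
  rw [measureReal_def, gaussianReal_apply_eq_integral _ one_ne_zero, ENNReal.toReal_ofReal
    (setIntegral_nonneg measurableSet_Ici fun x _ => gaussianPDFReal_nonneg _ _ _),
    integral_Ici_eq_integral_Ioi]
  have hneg : -a < 0 := by linarith
  have h1 : ∫ x in Set.Ioi (a + u), gaussianPDFReal 0 1 x
      ≤ ∫ x in Set.Ioi (a + u), (√(2 * Real.pi))⁻¹ * Real.exp (a ^ 2 / 2) * Real.exp (-a * x) := by
    refine setIntegral_mono_on (integrable_gaussianPDFReal 0 1).integrableOn
      ((integrableOn_exp_mul_Ioi hneg _).const_mul _) measurableSet_Ioi fun x _ => ?_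
    simp only [gaussianPDFReal, NNReal.coe_one, mul_one, sub_zero]
    rw [mul_assoc, ← Real.exp_add]
    gcongr
    nlinarith [sq_nonneg (x - a)]
  refine h1.trans (le_of_eq ?_)
  rw [integral_const_mul, integral_exp_mul_Ioi hneg, neg_div_neg_eq]
  have : Real.exp (-a * (a + u)) = Real.exp (-(a ^ 2)) * Real.exp (-(a * u)) := by
    rw [← Real.exp_add]; ring_nf
  have h2 : Real.exp (a ^ 2 / 2) * Real.exp (-(a ^ 2)) = Real.exp (-(a ^ 2 / 2)) := by
    rw [← Real.exp_add]; ring_nf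
  rw [this, ← h2]
  ring

/-- This is the conditional probability that the second variable of a pair with correlation `r` lies
in the window, given that the first equals `x` in it. The bound on `|r| * (a² + 1)` keeps the shift
`r * x` below `1 / a`, so `y ≥ a - 1 / a` and the exponential factor grows by at most `e`; `|r| ≤ 1
/ 2` bounds the normalisation by a factor `2`. -/
lemma gaussianReal_shifted_Icc_le {a r x : ℝ} (ha : 0 < a) (hr : |r| ≤ 1 / 2)
    (hra : |r| * (a ^ 2 + 1) ≤ 1) (hx : x ∈ Set.Icc a (a + a⁻¹)) :
    gaussianReal 0 (1 - r ^ 2).toNNReal {y | y + r * x ∈ Set.Icc a (a + a⁻¹)}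
      ≤ ENNReal.ofReal (2 * (√(2 * Real.pi))⁻¹ * Real.exp (1 - a ^ 2 / 2) * a⁻¹) := by
  have hr2 : r ^ 2 ≤ 1 / 4 := by
    rw [← sq_abs]; nlinarith [abs_nonneg r]
  have hv : 0 < 1 - r ^ 2 := by linarith
  have hset : {y | y + r * x ∈ Set.Icc a (a + a⁻¹)}
      = Set.Icc (a - r * x) (a + a⁻¹ - r * x) := by
    ext y
    simp only [Set.mem_ofPred_eq, Set.mem_Icc]
    constructor <;> rintro ⟨h1, h2⟩ <;> constructor <;> linarith
  have hrx : r * x ≤ a⁻¹ := by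
    have h1 : r * x ≤ |r| * (a + a⁻¹) :=
      (le_abs_self _).trans ((abs_mul r x).trans_le (by
        rw [abs_of_pos (ha.trans_le hx.1)]
        exact mul_le_mul_of_nonneg_left hx.2 (abs_nonneg r)))
    refine h1.trans ?_
    have : |r| * (a + a⁻¹) = |r| * (a ^ 2 + 1) * a⁻¹ := by field_simp
    rw [this]
    exact mul_le_of_le_one_left (by positivity) hra
  rw [hset]
  refine (gaussianReal_le_of_gaussianPDFReal_le (B := 2 * (√(2 * Real.pi))⁻¹ *
    Real.exp (1 - a ^ 2 / 2)) (by simpa using hv) measurableSet_Icc fun y hy => ?_).trans ?_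
  · simp only [gaussianPDFReal, sub_zero, Real.coe_toNNReal _ hv.le]
    have h1 : (√(2 * Real.pi * (1 - r ^ 2)))⁻¹ ≤ 2 * (√(2 * Real.pi))⁻¹ := by
      rw [Real.sqrt_mul (by positivity), mul_inv, mul_comm]
      have : 1 / 2 ≤ √(1 - r ^ 2) := Real.le_sqrt_of_sq_le (by linarith)
      have := inv_anti₀ (by norm_num) this
      gcongr
      simpa using this
    have hya : a - a⁻¹ ≤ y := by linarith [hy.1]
    have hy2 : a ^ 2 - 2 ≤ y ^ 2 := by
      rcases le_total (a ^ 2) 2 with h | h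
      · nlinarith [sq_nonneg y]
      · have h3 : a * a⁻¹ = 1 := mul_inv_cancel₀ ha.ne'
        have h4 : 0 ≤ a - a⁻¹ := by
          have : a⁻¹ ≤ a := by
            rw [inv_le_iff_one_le_mul₀ ha]; nlinarith
          linarith
        nlinarith [sq_nonneg a⁻¹]
    have h2 : -y ^ 2 / (2 * (1 - r ^ 2)) ≤ 1 - a ^ 2 / 2 := by
      have : y ^ 2 / 2 ≤ y ^ 2 / (2 * (1 - r ^ 2)) := by
        gcongr
        nlinarith [sq_nonneg r]
      rw [neg_div]
      linarith
    gcongr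
  · rw [Real.volume_Icc, ← ENNReal.ofReal_mul (by positivity)]
    exact ENNReal.ofReal_le_ofReal (le_of_eq (by ring))

/-! ### Pairs of correlated Gaussian variables -/

lemma prod_apply_mem_and_le {μ ν : Measure ℝ} [SFinite μ] [SFinite ν] {A : Set ℝ}
    (hA : MeasurableSet A) {r : ℝ} {K : ℝ≥0∞}
    (hK : ∀ x ∈ A, ν {y | y + r * x ∈ A} ≤ K) :
    (μ.prod ν) {p | p.1 ∈ A ∧ p.2 + r * p.1 ∈ A} ≤ K * μ A := by
  have hm : MeasurableSet {p : ℝ × ℝ | p.1 ∈ A ∧ p.2 + r * p.1 ∈ A} :=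
    (hA.preimage measurable_fst).inter (hA.preimage (by fun_prop))
  rw [Measure.prod_apply hm, ← setLIntegral_const, ← lintegral_indicator hA]
  refine lintegral_mono fun x => ?_
  by_cases hx : x ∈ A
  · simpa [hx, Set.preimage] using hK x hx
  · simp [hx, Set.preimage]

/-- Two standard Gaussian variables with correlation at most of order `a⁻²` lie in the window
`[a, a + 1 / a]` simultaneously with probability at most a constant times what independence
would give. -/
lemma measureReal_linearFunctional_mem_Icc_pair_le {n : ℕ} {w v : Fin n → ℝ} {a r : ℝ}
    (hw : ∑ i, w i ^ 2 = 1) (hv : ∑ i, v i ^ 2 = 1) (hwv : ∑ i, w i * v i = r)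
    (ha : 0 < a) (hr : |r| ≤ 1 / 2) (hra : |r| * (a ^ 2 + 1) ≤ 1) :
    (Measure.pi fun _ : Fin n => gaussianReal 0 1).real
      {x | linearFunctional w x ∈ Set.Icc a (a + a⁻¹) ∧
        linearFunctional v x ∈ Set.Icc a (a + a⁻¹)}
      ≤ 2 * (√(2 * Real.pi))⁻¹ * Real.exp (1 - a ^ 2 / 2) * a⁻¹ *
        (gaussianReal 0 1).real (Set.Icc a (a + a⁻¹)) := by
  set A := Set.Icc a (a + a⁻¹)
  set γ := Measure.pi fun _ : Fin n => gaussianReal 0 1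
  -- Gram–Schmidt: `u` is orthogonal to `w` with squared norm `1 - r²`, so the second variable is
  -- `r` times the first plus an independent Gaussian.
  set u : Fin n → ℝ := fun i => v i - r * w i
  have hwu : ∑ i, w i * u i = 0 := by
    have : ∀ i, w i * u i = w i * v i - r * w i ^ 2 := fun i => by simp only [u]; ring
    simp_rw [this, Finset.sum_sub_distrib, ← Finset.mul_sum]
    rw [hw, hwv]; ring
  have huu : ∑ i, u i ^ 2 = 1 - r ^ 2 := by
    have : ∀ i, u i ^ 2 = v i ^ 2 - 2 * r * (w i * v i) + r ^ 2 * w i ^ 2 := fun i => by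
      simp only [u]; ring
    simp_rw [this, Finset.sum_add_distrib, Finset.sum_sub_distrib, ← Finset.mul_sum]
    rw [hw, hv, hwv]; ring
  have hlin : ∀ x, linearFunctional v x = linearFunctional u x + r * linearFunctional w x := by
    intro x
    simp only [linearFunctional_apply, Finset.mul_sum, ← Finset.sum_add_distrib, u]
    exact Finset.sum_congr rfl fun i _ => by ring
  have hlaw := (indepFun_linearFunctional hwu).hasLaw_prod
    (hasLaw_linearFunctional w) (hasLaw_linearFunctional u)
  rw [hw, huu, Real.toNNReal_one] at hlaw
  have hA : MeasurableSet A := measurableSet_Icc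
  have h1 := hlaw.measure_eq (p := fun p : ℝ × ℝ => p.1 ∈ A ∧ p.2 + r * p.1 ∈ A)
    ((hA.preimage measurable_fst).inter (hA.preimage (by fun_prop)))
  have h2 := prod_apply_mem_and_le (μ := gaussianReal 0 1)
    (ν := gaussianReal 0 (1 - r ^ 2).toNNReal) hA
    fun x hx => gaussianReal_shifted_Icc_le ha hr hra hx
  rw [← h1] at h2
  simp_rw [hlin]
  have h3 := ENNReal.toReal_mono (by finiteness) h2
  rwa [ENNReal.toReal_mul, ENNReal.toReal_ofReal (by positivity)] at h3

/-! ### The second moment method -/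

/-- A lower bound for the probability of a union by the second moment method. -/
lemma div_le_measureReal_biUnion {Ω ι : Type*} [MeasurableSpace Ω] {μ : Measure Ω}
    [IsProbabilityMeasure μ] {S : Finset ι} {A : ι → Set Ω} (hA : ∀ i, MeasurableSet (A i))
    {q K : ℝ} (hK : 0 ≤ K) (hq : ∀ i ∈ S, μ.real (A i) = q) (hq0 : 0 ≤ q)
    (hpair : ∀ i ∈ S, ∀ j ∈ S, i ≠ j → μ.real (A i ∩ A j) ≤ K * q ^ 2) :
    S.card * q / (1 + K * (S.card * q)) ≤ μ.real (⋃ i ∈ S, A i) := by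
  classical
  set z := S.card * q
  have hz0 : 0 ≤ z := by positivity
  -- With `Z` the number of events that occur, `2θZ - θ²Z²` is at most the indicator of the union.
  -- This `θ` maximises the resulting bound `2θz - θ²(z + Kz²)`.
  set θ := 1 / (1 + K * z)
  have hθ : 0 ≤ θ := by positivity
  set Z : Ω → ℝ := fun ω => ∑ i ∈ S, (A i).indicator 1 ω
  have hint : ∀ s : Set Ω, MeasurableSet s → Integrable (s.indicator (1 : Ω → ℝ)) μ :=
    fun s hs => (integrable_const (1 : ℝ)).indicator hs
  have hval : ∀ s : Set Ω, MeasurableSet s → ∫ ω, s.indicator (1 : Ω → ℝ) ω ∂μ = μ.real s :=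
    fun s hs => integral_indicator_one hs
  have hZ2 : ∀ ω, Z ω ^ 2 = ∑ i ∈ S, ∑ j ∈ S, (A i ∩ A j).indicator (1 : Ω → ℝ) ω := fun ω => by
    simp only [Z, sq, Finset.sum_mul_sum, Set.inter_indicator_one, Pi.mul_apply]
  have hIZ : ∫ ω, Z ω ∂μ = z := by
    simp only [Z]
    rw [integral_finsetSum _ fun i _ => hint _ (hA i)]
    rw [Finset.sum_congr rfl fun i hi => (hval _ (hA i)).trans (hq i hi)]
    simp [z]
  have hiZ : Integrable Z μ := integrable_finsetSum _ fun i _ => hint _ (hA i)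
  have hiZ2 : Integrable (fun ω => Z ω ^ 2) μ := by
    simp_rw [hZ2]
    exact integrable_finsetSum _ fun i _ => integrable_finsetSum _ fun j _ =>
      hint _ ((hA i).inter (hA j))
  have hIZ2 : ∫ ω, Z ω ^ 2 ∂μ ≤ z + K * z ^ 2 := by
    simp_rw [hZ2]
    rw [integral_finsetSum _ fun i _ => integrable_finsetSum _ fun j _ =>
      hint _ ((hA i).inter (hA j))]
    have : ∀ i ∈ S, ∫ ω, ∑ j ∈ S, (A i ∩ A j).indicator (1 : Ω → ℝ) ω ∂μ
        ≤ q + S.card * (K * q ^ 2) := by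
      intro i hi
      rw [integral_finsetSum _ fun j _ => hint _ ((hA i).inter (hA j))]
      calc _ ≤ ∑ j ∈ S, ((if i = j then q else 0) + K * q ^ 2) := by
            refine Finset.sum_le_sum fun j hj => ?_
            rw [hval _ ((hA i).inter (hA j))]
            split_ifs with h
            · subst h
              rw [Set.inter_self, hq i hi]
              exact le_add_of_nonneg_right (by positivity)
            · simpa using hpair i hi j hj h
        _ = _ := by simp [Finset.sum_add_distrib, hi]
    refine (Finset.sum_le_sum this).trans (le_of_eq ?_)
    simp only [Finset.sum_const, nsmul_eq_mul, z]
    ring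
  have hU : MeasurableSet (⋃ i ∈ S, A i) := S.measurableSet_biUnion fun i _ => hA i
  have hpt : ∀ ω, 2 * θ * Z ω - θ ^ 2 * Z ω ^ 2 ≤ (⋃ i ∈ S, A i).indicator (1 : Ω → ℝ) ω := by
    intro ω
    by_cases h : ω ∈ ⋃ i ∈ S, A i
    · rw [Set.indicator_of_mem h, Pi.one_apply]
      nlinarith [sq_nonneg (1 - θ * Z ω)]
    · have : Z ω = 0 := Finset.sum_eq_zero fun i hi =>
        Set.indicator_of_notMem (fun hω => h (Set.mem_biUnion hi hω)) _
      rw [Set.indicator_of_notMem h, this]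
      simp
  have hfin : 2 * θ * z - θ ^ 2 * (z + K * z ^ 2) ≤ μ.real (⋃ i ∈ S, A i) := by
    calc 2 * θ * z - θ ^ 2 * (z + K * z ^ 2)
        ≤ 2 * θ * ∫ ω, Z ω ∂μ - θ ^ 2 * ∫ ω, Z ω ^ 2 ∂μ := by rw [hIZ]; gcongr
      _ = ∫ ω, (2 * θ * Z ω - θ ^ 2 * Z ω ^ 2) ∂μ := by
        rw [integral_sub (hiZ.const_mul _) (hiZ2.const_mul _), integral_const_mul,
          integral_const_mul]
      _ ≤ ∫ ω, (⋃ i ∈ S, A i).indicator (1 : Ω → ℝ) ω ∂μ :=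
        integral_mono ((hiZ.const_mul _).sub (hiZ2.const_mul _)) (hint _ hU) hpt
      _ = _ := hval _ hU
  refine le_trans (le_of_eq ?_) hfin
  simp only [θ]
  field_simp
  ring

/-! ### Concentration of log-concave distribution functions -/

/-- Log-concavity makes the ratios of consecutive terms nonincreasing, so the first ratio bounds
them all. Once a term vanishes, monotonicity keeps the later ones zero. -/
lemma le_pow_of_mul_le_sq {r : ℕ → ℝ} (h0 : ∀ k, 0 ≤ r k) (hanti : Antitone r)
    (hlc : ∀ k, r k * r (k + 2) ≤ r (k + 1) ^ 2) {θ : ℝ} (hθ : 0 ≤ θ) (hr0 : r 0 ≤ 1)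
    (hr1 : r 1 ≤ θ * r 0) (k : ℕ) : r k ≤ θ ^ k := by
  have step : ∀ k, r (k + 1) ≤ θ * r k := by
    intro k
    induction k with
    | zero => exact hr1
    | succ k ih =>
      rcases (h0 k).eq_or_lt with h | h
      · rw [← h, mul_zero] at ih
        have h1 : r (k + 1) = 0 := le_antisymm ih (h0 _)
        have h2 := hanti (Nat.le_succ (k + 1))
        rw [h1] at h2 ⊢
        simpa using h2
      · refine le_of_mul_le_mul_left ?_ h
        calc r k * r (k + 1 + 1) ≤ r (k + 1) * r (k + 1) := by rw [← sq]; exact hlc k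
          _ ≤ θ * r k * r (k + 1) := mul_le_mul_of_nonneg_right ih (h0 _)
          _ = _ := by ring
  induction k with
  | zero => simpa using hr0
  | succ k ih =>
    calc r (k + 1) ≤ θ * r k := step k
      _ ≤ θ * θ ^ k := by gcongr
      _ = _ := by ring

/-- A random variable with midpoint log-concave distribution function, an exponential upper tail
at scale `s` beyond `m`, and a positive chance of exceeding `m`, is concentrated around `m` at
scale `s`. -/
lemma exists_measureReal_le_abs_sub_le (δ : ℝ) (hδ0 : 0 < δ) (hδ1 : δ < 1) :
    ∃ c : ℝ, 0 < c ∧ ∀ {Ω : Type*} [MeasurableSpace Ω] (μ : Measure Ω) [IsProbabilityMeasure μ]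
      (M : Ω → ℝ) (m s : ℝ), Measurable M → 0 < s →
      (∀ t u, μ.real {x | M x < t} * μ.real {x | M x < u}
        ≤ μ.real {x | M x < (t + u) / 2} ^ 2) →
      (∀ t, 0 ≤ t → μ.real {x | m + t ≤ M x} ≤ 2 * Real.exp (-(t / (3 * s)))) →
      δ ≤ μ.real {x | m ≤ M x} →
      ∀ t, 0 ≤ t → μ.real {x | t ≤ |M x - m|} ≤ 3 * Real.exp (-(c * t / s)) := by
  -- Chosen so that the upper tail bound at distance `K * s` equals `δ / 2`. The distribution
  -- function is then at least `1 - δ / 2` at `m + K * s` and at most `1 - δ` at `m`, with ratio at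
  -- most `θ < 1`.
  set K := 3 * Real.log (4 / δ)
  have hK : 0 < K := mul_pos three_pos (Real.log_pos (by rw [lt_div_iff₀ hδ0]; linarith))
  set θ := (1 - δ) / (1 - δ / 2)
  have hθ0 : 0 < θ := div_pos (by linarith) (by linarith)
  have hθ1 : θ < 1 := by rw [div_lt_one (by linarith)]; linarith
  have hlog : 0 < -Real.log θ := neg_pos.2 (Real.log_neg hθ0 hθ1)
  refine ⟨min (1 / 3) (-Real.log θ / K), lt_min (by norm_num) (div_pos hlog hK), ?_⟩
  intro Ω _ μ _ M m s hM hs hlc hup hlow t ht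
  set c := min (1 / 3) (-Real.log θ / K)
  have hΔ : 0 < K * s := mul_pos hK hs
  have hcompl : ∀ y, μ.real {x | M x < y} = 1 - μ.real {x | y ≤ M x} := fun y => by
    have : {x | M x < y} = {x | y ≤ M x}ᶜ := by ext; simp
    rw [this, probReal_compl_eq_one_sub (measurableSet_le measurable_const hM)]
  set r : ℕ → ℝ := fun k => μ.real {x | M x < m + K * s - k * (K * s)}
  have hr0 : 1 - δ / 2 ≤ r 0 := by
    have h1 := hup (K * s) hΔ.le
    have h2 : 2 * Real.exp (-(K * s / (3 * s))) = δ / 2 := by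
      have : K * s / (3 * s) = Real.log (4 / δ) := by simp only [K]; field_simp
      rw [this, ← Real.log_inv, Real.exp_log (by positivity)]
      field_simp; norm_num
    simp only [r, Nat.cast_zero, zero_mul, sub_zero]
    rw [hcompl]
    linarith
  have hr1 : r 1 ≤ 1 - δ := by
    simp only [r, Nat.cast_one, one_mul, add_sub_cancel_right]
    rw [hcompl]
    linarith
  have hpow : ∀ k, r k ≤ θ ^ k := by
    refine le_pow_of_mul_le_sq (fun k => measureReal_nonneg) ?_ ?_ hθ0.le measureReal_le_one ?_
    · intro j k hjk
      refine measureReal_mono fun x (hx : M x < _) => lt_of_lt_of_le hx ?_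
      gcongr
    · intro k
      have e : (m + K * s - (k : ℝ) * (K * s) + (m + K * s - ((k + 2 : ℕ) : ℝ) * (K * s))) / 2
          = m + K * s - ((k + 1 : ℕ) : ℝ) * (K * s) := by push_cast; ring
      have h := hlc (m + K * s - (k : ℝ) * (K * s)) (m + K * s - ((k + 2 : ℕ) : ℝ) * (K * s))
      rwa [e] at h
    · refine hr1.trans ?_
      have : 1 - δ = θ * (1 - δ / 2) := by
        simp only [θ]; rw [div_mul_cancel₀]; linarith
      rw [this]
      gcongr
  have hlower : μ.real {x | M x ≤ m - t} ≤ Real.exp (-(c * t / s)) := by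
    -- The grid starts one step above `m`, so its `k`-th point `m + K * s - k * (K * s)` lies
    -- strictly above `m - t`.
    set k := ⌈t / (K * s)⌉₊
    have hk1 : t / (K * s) ≤ k := Nat.le_ceil _
    have hk2 : (k : ℝ) < t / (K * s) + 1 := Nat.ceil_lt_add_one (by positivity)
    have hk3 : k * (K * s) < t + K * s := by
      calc k * (K * s) < (t / (K * s) + 1) * (K * s) := by gcongr
        _ = _ := by field_simp
    calc μ.real {x | M x ≤ m - t} ≤ r k :=
          measureReal_mono fun x (hx : M x ≤ m - t) => show M x < _ by linarith
      _ ≤ θ ^ k := hpow k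
      _ = Real.exp (k * Real.log θ) := by rw [Real.exp_nat_mul, Real.exp_log hθ0]
      _ ≤ _ := by
        gcongr
        have h1 : -Real.log θ * (t / (K * s)) ≤ -Real.log θ * k := by gcongr
        have h2 : c * t / s ≤ -Real.log θ / K * t / s := by gcongr; exact min_le_right _ _
        have h3 : -Real.log θ / K * t / s = -Real.log θ * (t / (K * s)) := by field_simp
        linarith
  have hupper : μ.real {x | m + t ≤ M x} ≤ 2 * Real.exp (-(c * t / s)) := by
    refine (hup t ht).trans ?_
    have h2 : c * t / s ≤ 1 / 3 * t / s := by gcongr; exact min_le_left _ _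
    have h3 : 1 / 3 * t / s = t / (3 * s) := by field_simp
    have h4 : -(t / (3 * s)) ≤ -(c * t / s) := by linarith
    linarith [Real.exp_le_exp.2 h4]
  calc μ.real {x | t ≤ |M x - m|} ≤ μ.real ({x | M x ≤ m - t} ∪ {x | m + t ≤ M x}) := by
        refine measureReal_mono fun x (hx : t ≤ |M x - m|) => ?_
        rcases le_abs.1 hx with h | h
        · exact Or.inr (show m + t ≤ M x by linarith)
        · exact Or.inl (show M x ≤ m - t by linarith)
    _ ≤ _ := (measureReal_union_le _ _).trans (by linarith)

/-- Exponential concentration around a point implies exponential concentration around the mean. -/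
lemma measureReal_le_abs_sub_integral_le {Ω : Type*} [MeasurableSpace Ω] {μ : Measure Ω}
    [IsProbabilityMeasure μ] {M : Ω → ℝ} (hM : Integrable M μ) {m κ : ℝ} (hκ : 0 < κ)
    (h : ∀ t, 0 ≤ t → μ.real {x | t ≤ |M x - m|} ≤ 3 * Real.exp (-(κ * t))) {t : ℝ} :
    μ.real {x | t ≤ |M x - ∫ y, M y ∂μ|} ≤ 6 * Real.exp (-(κ * t / 3)) := by
  have hint : Integrable (fun x => |M x - m|) μ := (hM.sub (integrable_const m)).abs
  have hneg : -κ < 0 := by linarith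
  -- Integrating the tail bound controls `E|M - m|`, hence the displacement of the centre.
  have hmean : |(∫ y, M y ∂μ) - m| ≤ 3 / κ := by
    have h1 : (∫ y, M y ∂μ) - m = ∫ y, (M y - m) ∂μ := by
      rw [integral_sub hM (integrable_const m)]; simp
    rw [h1]
    refine abs_integral_le_integral_abs.trans ?_
    rw [hint.integral_eq_integral_meas_le (.of_forall fun _ => abs_nonneg _)]
    have h2 : ∫ t in Set.Ioi (0 : ℝ), 3 * Real.exp (-κ * t) = 3 / κ := by
      rw [integral_const_mul, integral_exp_mul_Ioi hneg]
      simp [div_eq_mul_inv]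
    rw [← h2]
    refine integral_mono_of_nonneg (.of_forall fun _ => measureReal_nonneg)
      ((integrableOn_exp_mul_Ioi hneg 0).const_mul 3) ?_
    filter_upwards [ae_restrict_mem measurableSet_Ioi] with t ht
    rw [neg_mul]
    exact h t (le_of_lt ht)
  have hp1 : μ.real {x | t ≤ |M x - ∫ y, M y ∂μ|} ≤ 1 := measureReal_le_one
  have he3 : Real.exp 3 ≤ 72 := by
    have h3 : Real.exp 3 = Real.exp 1 ^ 3 := by rw [← Real.exp_nat_mul]; norm_num
    rw [h3]
    have h2 : Real.exp 1 ≤ 3 := Real.exp_one_lt_three.le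
    calc Real.exp 1 ^ 3 ≤ 3 ^ 3 := by gcongr
      _ ≤ 72 := by norm_num
  have hp2 : μ.real {x | t ≤ |M x - ∫ y, M y ∂μ|} ≤ 216 * Real.exp (-(κ * t)) := by
    rcases le_or_gt (3 / κ) t with ht | ht
    · calc _ ≤ μ.real {x | t - 3 / κ ≤ |M x - m|} := by
            refine measureReal_mono fun x (hx : t ≤ |M x - ∫ y, M y ∂μ|) => ?_
            have := abs_sub_le (M x) m (∫ y, M y ∂μ)
            rw [abs_sub_comm m] at this
            exact show t - 3 / κ ≤ |M x - m| by linarith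
        _ ≤ 3 * Real.exp (-(κ * (t - 3 / κ))) := h _ (by linarith)
        _ = 3 * (Real.exp 3 * Real.exp (-(κ * t))) := by
            rw [← Real.exp_add]
            congr 2
            field_simp
            ring
        _ ≤ _ := by nlinarith [Real.exp_pos (-(κ * t))]
    · refine hp1.trans ?_
      have h1 : κ * t < 3 := by rw [lt_div_iff₀ hκ] at ht; linarith
      have h2 : Real.exp (-3) ≤ Real.exp (-(κ * t)) := by gcongr
      have h3 : 1 / 72 ≤ Real.exp (-3) := by
        rw [Real.exp_neg, one_div]
        exact inv_anti₀ (Real.exp_pos _) he3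
      linarith
  -- A probability `p` satisfies `p³ ≤ p ≤ 216 * exp (-κt)`, and `216 = 6³`: a cube root trades a
  -- factor `3` in the rate for the prefactor `6`.
  refine le_of_pow_le_pow_left₀ (n := 3) (by norm_num) (by positivity) ?_
  rw [mul_pow, ← Real.exp_nat_mul]
  have h1 : ((3 : ℕ) : ℝ) * -(κ * t / 3) = -(κ * t) := by push_cast; ring
  rw [h1]
  refine (pow_le_of_le_one measureReal_nonneg hp1 (by norm_num)).trans (hp2.trans ?_)
  norm_num

/-! ### The maximum of the field over nearly orthogonal sign vectors -/

lemma measurable_maxField {n : ℕ} {S : Finset (SignVec n)} (hS : S.Nonempty) :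
    Measurable (maxField (fun i (x : Fin n → ℝ) => x i) S hS) := by
  have : maxField (fun i (x : Fin n → ℝ) => x i) S hS
      = S.sup' hS fun σ x => signField (fun i (x : Fin n → ℝ) => x i) σ x := by
    ext x; simp [maxField, Finset.sup'_apply]
  rw [this]
  refine Finset.measurable_sup' hS fun σ _ => ?_
  unfold signField
  fun_prop

/-- A maximum of linear functionals is convex; this is what lets Prékopa–Leindler act on it. -/
lemma maxField_midpoint_le {n : ℕ} {S : Finset (SignVec n)} (hS : S.Nonempty) (x y : Fin n → ℝ) :
    maxField (fun i (x : Fin n → ℝ) => x i) S hS ((2⁻¹ : ℝ) • (x + y))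
      ≤ (maxField (fun i (x : Fin n → ℝ) => x i) S hS x
        + maxField (fun i (x : Fin n → ℝ) => x i) S hS y) / 2 := by
  refine Finset.sup'_le hS _ fun σ hσ => ?_
  have h1 := Finset.le_sup' (fun σ => signField (fun i (x : Fin n → ℝ) => x i) σ x) hσ
  have h2 := Finset.le_sup' (fun σ => signField (fun i (x : Fin n → ℝ) => x i) σ y) hσ
  have h3 : signField (fun i (x : Fin n → ℝ) => x i) σ ((2⁻¹ : ℝ) • (x + y))
      = (signField (fun i (x : Fin n → ℝ) => x i) σ x
        + signField (fun i (x : Fin n → ℝ) => x i) σ y) / 2 := by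
    simp only [signField, Pi.smul_apply, Pi.add_apply, smul_eq_mul]
    rw [← Finset.sum_add_distrib, Finset.sum_div]
    exact Finset.sum_congr rfl fun i _ => by ring
  rw [h3]
  unfold maxField
  linarith

lemma integrable_maxField {n : ℕ} {S : Finset (SignVec n)} (hS : S.Nonempty) :
    Integrable (maxField (fun i (x : Fin n → ℝ) => x i) S hS)
      (Measure.pi fun _ : Fin n => gaussianReal 0 1) := by
  have hi : ∀ i : Fin n, Integrable (fun x : Fin n → ℝ => |x i|)
      (Measure.pi fun _ : Fin n => gaussianReal 0 1) := fun i =>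
    ((memLp_eval_pi_gaussianReal i).integrable one_le_two).abs
  refine (integrable_finsetSum Finset.univ fun i _ => hi i).mono'
    (measurable_maxField hS).aestronglyMeasurable (.of_forall fun x => ?_)
  have hb : ∀ σ : SignVec n, |signField (fun i (x : Fin n → ℝ) => x i) σ x| ≤ ∑ i, |x i| := by
    intro σ
    refine (Finset.abs_sum_le_sum_abs _ _).trans (le_of_eq (Finset.sum_congr rfl fun i _ => ?_))
    rcases Int.units_eq_one_or (σ i) with h | h <;> simp [h]
  obtain ⟨σ, hσ, hmax⟩ := Finset.exists_mem_eq_sup' hS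
    (fun σ => signField (fun i (x : Fin n → ℝ) => x i) σ x)
  rw [Real.norm_eq_abs, maxField, hmax]
  exact hb σ

/-- The unit vector in the direction of a sign vector. -/
noncomputable def SignVec.unit {n : ℕ} (σ : SignVec n) : Fin n → ℝ :=
  fun i => ((σ i : ℤ) : ℝ) / √n

lemma SignVec.sum_unit_mul_unit {n : ℕ} (σ τ : SignVec n) :
    ∑ i, σ.unit i * τ.unit i = overlap σ τ / n := by
  simp only [SignVec.unit, overlap]
  push_cast
  rw [Finset.sum_div]
  refine Finset.sum_congr rfl fun i _ => ?_
  rw [div_mul_div_comm, Real.mul_self_sqrt (Nat.cast_nonneg n)]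

lemma SignVec.sum_unit_sq {n : ℕ} (hn : 1 ≤ n) (σ : SignVec n) : ∑ i, σ.unit i ^ 2 = 1 := by
  have hn0 : (n : ℝ) ≠ 0 := by positivity
  have : overlap σ σ = n := by
    have h : ∀ i, (σ i : ℤ) * (σ i : ℤ) = 1 := fun i => by
      rcases Int.units_eq_one_or (σ i) with h | h <;> simp [h]
    simp [overlap, h]
  simp_rw [sq]
  rw [SignVec.sum_unit_mul_unit, this]
  simpa using div_self hn0

lemma SignVec.signField_eq {n : ℕ} (hn : 1 ≤ n) (σ : SignVec n) (x : Fin n → ℝ) :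
    signField (fun i (x : Fin n → ℝ) => x i) σ x = √n * linearFunctional σ.unit x := by
  have hn0 : √(n : ℝ) ≠ 0 := by positivity
  rw [linearFunctional_apply, signField, Finset.mul_sum]
  refine Finset.sum_congr rfl fun i _ => ?_
  rw [SignVec.unit]
  field_simp

lemma SignVec.hasLaw_unit {n : ℕ} (hn : 1 ≤ n) (σ : SignVec n) :
    HasLaw (linearFunctional σ.unit) (gaussianReal 0 1)
      (Measure.pi fun _ : Fin n => gaussianReal 0 1) := by
  have := hasLaw_linearFunctional σ.unit
  rwa [SignVec.sum_unit_sq hn, Real.toNNReal_one] at this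

lemma inv_sqrt_two_mul_pi_le : (√(2 * Real.pi))⁻¹ ≤ 1 / 2 := by
  rw [one_div]
  refine inv_anti₀ two_pos (Real.le_sqrt_of_sq_le ?_)
  nlinarith [Real.pi_gt_three]

/-- The union bound for the upper tail of the maximum. -/
lemma measureReal_le_maxField_le {n : ℕ} (hn : 1 ≤ n) {S : Finset (SignVec n)} (hS : S.Nonempty)
    {a : ℝ} (ha : 0 < a) (hcard : (S.card : ℝ) ≤ 4 * (a * Real.exp (a ^ 2 / 2))) (u : ℝ) :
    (Measure.pi fun _ : Fin n => gaussianReal 0 1).real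
      {x | √n * (a + u) ≤ maxField (fun i (x : Fin n → ℝ) => x i) S hS x}
      ≤ 2 * Real.exp (-(a * u)) := by
  have hn0 : 0 < √(n : ℝ) := by positivity
  have hsub : {x : Fin n → ℝ | √n * (a + u) ≤ maxField (fun i (x : Fin n → ℝ) => x i) S hS x}
      ⊆ ⋃ σ ∈ S, {x | linearFunctional σ.unit x ∈ Set.Ici (a + u)} := by
    intro x (hx : √n * (a + u) ≤ maxField (fun i (x : Fin n → ℝ) => x i) S hS x)
    obtain ⟨σ, hσ, h⟩ := (Finset.le_sup'_iff hS).1 hx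
    rw [SignVec.signField_eq hn] at h
    exact Set.mem_biUnion hσ (le_of_mul_le_mul_left h hn0)
  refine (measureReal_mono hsub (measure_ne_top _ _)).trans ((measureReal_biUnion_finset_le _ _).trans ?_)
  calc _ ≤ ∑ σ ∈ S, (√(2 * Real.pi))⁻¹ * Real.exp (-(a ^ 2 / 2)) * a⁻¹ * Real.exp (-(a * u)) := by
        refine Finset.sum_le_sum fun σ _ => ?_
        have h := (SignVec.hasLaw_unit hn σ).measureReal_eq (p := fun y => y ∈ Set.Ici (a + u))
          measurableSet_Ici
        exact h.trans_le (gaussianReal_real_Ici_le ha)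
    _ = S.card * ((√(2 * Real.pi))⁻¹ * (Real.exp (-(a ^ 2 / 2)) * a⁻¹ * Real.exp (-(a * u)))) := by
        rw [Finset.sum_const, nsmul_eq_mul]; ring
    _ ≤ 4 * (a * Real.exp (a ^ 2 / 2)) *
        (1 / 2 * (Real.exp (-(a ^ 2 / 2)) * a⁻¹ * Real.exp (-(a * u)))) := by
        gcongr
        exact inv_sqrt_two_mul_pi_le
    _ = 2 * (Real.exp (a ^ 2 / 2) * Real.exp (-(a ^ 2 / 2))) * Real.exp (-(a * u)) := by
        field_simp; norm_num
    _ = _ := by rw [← Real.exp_add]; simp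

/-- The maximum over sufficiently many nearly orthogonal sign vectors is large with probability
bounded below. -/
lemma exists_le_measureReal_le_maxField :
    ∃ δ : ℝ, 0 < δ ∧ δ < 1 ∧ ∀ (n : ℕ), 1 ≤ n → ∀ (S : Finset (SignVec n)) (hS : S.Nonempty)
      (a : ℝ), 1 / 3 ≤ a → a * Real.exp (a ^ 2 / 2) / 4 ≤ S.card →
      (∀ σ ∈ S, ∀ τ ∈ S, σ ≠ τ → |(overlap σ τ : ℝ) / n| ≤ 1 / 2 ∧
        |(overlap σ τ : ℝ) / n| * (a ^ 2 + 1) ≤ 1) →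
      δ ≤ (Measure.pi fun _ : Fin n => gaussianReal 0 1).real
        {x | √n * a ≤ maxField (fun i (x : Fin n → ℝ) => x i) S hS x} := by
  set φ := (√(2 * Real.pi))⁻¹
  have hφ : 0 < φ := by positivity
  -- Since `1 / a ≤ 3`, `(a + 1/a)² / 2 ≤ a² / 2 + 11 / 2`, which bounds the window mass `q` below.
  -- Comparison with the pair estimate costs one more factor `e`, whence `13 / 2`; the `z` below is
  -- a lower bound for the expected number `S.card * q` of vectors in the window.
  set K := 2 * Real.exp (13 / 2) with hK
  set z := φ * Real.exp (-(11 / 2)) / 4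
  have hz : 0 < z := by positivity
  have hK1 : 1 ≤ K := by
    rw [hK]; linarith [Real.one_le_exp (show (0 : ℝ) ≤ 13 / 2 by norm_num)]
  have hK0 : 0 ≤ K := by linarith
  refine ⟨z / (1 + K * z), by positivity, ?_, ?_⟩
  · rw [div_lt_one (by positivity)]
    nlinarith
  intro n hn S hS a ha hcard hov
  have ha0 : 0 < a := by linarith
  have hn0 : 0 < √(n : ℝ) := by positivity
  set q := (gaussianReal 0 1).real (Set.Icc a (a + a⁻¹))
  have hainv : a⁻¹ ≤ 3 := by
    rw [inv_le_comm₀ ha0 three_pos]; linarith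
  have hq : φ * Real.exp (-(a ^ 2 / 2)) * Real.exp (-(11 / 2)) * a⁻¹ ≤ q := by
    refine le_trans ?_ (le_gaussianReal_real_Icc ha0)
    rw [mul_assoc φ, ← Real.exp_add]
    have h1 : a * a⁻¹ = 1 := mul_inv_cancel₀ ha0.ne'
    have h2 : 0 < a⁻¹ := by positivity
    gcongr
    nlinarith
  have hq0 : 0 ≤ q := measureReal_nonneg
  have hzq : z ≤ S.card * q := by
    calc z = a * Real.exp (a ^ 2 / 2) / 4 *
          (φ * Real.exp (-(a ^ 2 / 2)) * Real.exp (-(11 / 2)) * a⁻¹) := by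
          have : Real.exp (a ^ 2 / 2) * Real.exp (-(a ^ 2 / 2)) = 1 := by
            rw [← Real.exp_add]; simp
          calc z = z * (Real.exp (a ^ 2 / 2) * Real.exp (-(a ^ 2 / 2))) := by rw [this, mul_one]
            _ = _ := by simp only [z]; field_simp
      _ ≤ _ := by gcongr
  have hmeas : ∀ σ : SignVec n, MeasurableSet
      {x : Fin n → ℝ | linearFunctional σ.unit x ∈ Set.Icc a (a + a⁻¹)} := fun σ =>
    measurableSet_Icc.preimage (linearFunctional σ.unit).continuous.measurable
  have h2nd := div_le_measureReal_biUnion (μ := Measure.pi fun _ : Fin n => gaussianReal 0 1)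
    (S := S) (A := fun σ : SignVec n =>
      {x : Fin n → ℝ | linearFunctional σ.unit x ∈ Set.Icc a (a + a⁻¹)})
    hmeas (q := q) hK0 (fun σ _ => (SignVec.hasLaw_unit hn σ).measureReal_eq
      (p := fun y => y ∈ Set.Icc a (a + a⁻¹)) measurableSet_Icc) hq0
    (fun σ hσ τ hτ hne => by
      obtain ⟨h1, h2⟩ := hov σ hσ τ hτ hne
      refine (measureReal_linearFunctional_mem_Icc_pair_le (SignVec.sum_unit_sq hn σ)
        (SignVec.sum_unit_sq hn τ) (SignVec.sum_unit_mul_unit σ τ) ha0 h1 h2).trans ?_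
      rw [sq q, ← mul_assoc]
      refine mul_le_mul_of_nonneg_right ?_ hq0
      refine le_trans (le_of_eq ?_) (mul_le_mul_of_nonneg_left hq hK0)
      have : Real.exp (1 - a ^ 2 / 2)
          = Real.exp (13 / 2) * (Real.exp (-(a ^ 2 / 2)) * Real.exp (-(11 / 2))) := by
        rw [← Real.exp_add, ← Real.exp_add]; ring_nf
      rw [this, hK]
      ring)
  refine le_trans ?_ (h2nd.trans (measureReal_mono ?_ (measure_ne_top _ _)))
  · rw [div_le_div_iff₀ (by positivity) (by positivity)]
    nlinarith
  · intro x hx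
    obtain ⟨σ, hσ, h⟩ := Set.mem_iUnion₂.1 hx
    change √n * a ≤ maxField (fun i (x : Fin n → ℝ) => x i) S hS x
    refine (Finset.le_sup'_iff hS).2 ⟨σ, hσ, ?_⟩
    rw [SignVec.signField_eq hn]
    exact mul_le_mul_of_nonneg_left h.1 hn0.le

/-- The size `a * exp (a² / 2) / 4` is available because `a ≤ exp (a² / 2)` and `a² = s / 9 ≤ s /
8`. Rounding up adds at most `1`, which `a ≥ 1 / 3` absorbs into the factor `4`. -/
lemma exists_card_le_and_overlap_le {n : ℕ} (hn : 1 ≤ n) {s a : ℝ} (hs : 0 ≤ s)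
    (hs3 : s ^ 3 = n) (ha : 1 / 3 ≤ a) (has : 9 * a ^ 2 = s) :
    ∃ S : Finset (SignVec n), S.Nonempty ∧ a * Real.exp (a ^ 2 / 2) / 4 ≤ S.card ∧
      (S.card : ℝ) ≤ 4 * (a * Real.exp (a ^ 2 / 2)) ∧
      ∀ σ ∈ S, ∀ τ ∈ S, σ ≠ τ → |(overlap σ τ : ℝ)| ≤ s ^ 2 / 2 := by
  have ha0 : 0 < a := by linarith
  have hle : a * Real.exp (a ^ 2 / 2) / 4 ≤ Real.exp (s / 8) / 4 := by
    have h1 : a ≤ Real.exp (a ^ 2 / 2) :=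
      le_trans (by nlinarith [sq_nonneg (a - 1)]) (Real.add_one_le_exp (a ^ 2 / 2))
    calc a * Real.exp (a ^ 2 / 2) / 4
        ≤ Real.exp (a ^ 2 / 2) * Real.exp (a ^ 2 / 2) / 4 := by gcongr
      _ = Real.exp (a ^ 2) / 4 := by rw [← Real.exp_add]; ring_nf
      _ ≤ _ := by gcongr; nlinarith [sq_nonneg a]
  obtain ⟨S, hcard, hS⟩ := exists_card_eq_and_overlap_le hn hs hs3 hle
  refine ⟨S, ?_, ?_, ?_, hS⟩
  · rw [← Finset.card_pos, hcard]
    exact Nat.ceil_pos.2 (by positivity)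
  · rw [hcard]; exact Nat.le_ceil _
  · rw [hcard]
    refine (Nat.ceil_lt_add_one (by positivity)).le.trans ?_
    have : 1 ≤ Real.exp (a ^ 2 / 2) := Real.one_le_exp (by positivity)
    nlinarith

theorem mainTheorem5 :
    ∃ C c : ℝ, 0 < C ∧ 0 < c ∧ ∀ n : ℕ, 1 ≤ n →
      ∃ (S : Finset (SignVec n)) (hS : S.Nonempty),
        (∀ σ ∈ S, ∀ τ ∈ S, σ ≠ τ →
          |(overlap σ τ : ℝ)| ≤ C * (n : ℝ) ^ (2 / 3 : ℝ)) ∧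
        ∀ (Ω : Type*) [MeasurableSpace Ω] (P : Measure Ω) [IsProbabilityMeasure P]
          (X : Fin n → Ω → ℝ),
          iIndepFun X P → (∀ i, HasLaw (X i) (gaussianReal 0 1) P) →
          Integrable (maxField X S hS) P ∧
          ∀ t : ℝ, 0 ≤ t →
            P.real {ω | t ≤ |maxField X S hS ω - ∫ ω', maxField X S hS ω' ∂P|}
              ≤ 6 * Real.exp (-(c * t / (n : ℝ) ^ (1 / 3 : ℝ))) := by
  obtain ⟨δ, hδ0, hδ1, hδ⟩ := exists_le_measureReal_le_maxField
  obtain ⟨c, hc, hconc⟩ := exists_measureReal_le_abs_sub_le.{0} δ hδ0 hδ1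
  refine ⟨1 / 2, c / 3, by norm_num, by positivity, fun n hn => ?_⟩
  have hn1 : (1 : ℝ) ≤ n := by exact_mod_cast hn
  set s : ℝ := (n : ℝ) ^ (1 / 3 : ℝ)
  have hs1 : 1 ≤ s := Real.one_le_rpow hn1 (by norm_num)
  have hs0 : 0 < s := by linarith
  have hs3 : s ^ 3 = n := by
    rw [← Real.rpow_natCast, ← Real.rpow_mul (by positivity)]; norm_num
  have hs2 : s ^ 2 = (n : ℝ) ^ (2 / 3 : ℝ) := by
    rw [← Real.rpow_natCast, ← Real.rpow_mul (by positivity)]; norm_num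
  have hss : √s ^ 2 = s := Real.sq_sqrt hs0.le
  have hsn : √(n : ℝ) = s * √s := by
    rw [Real.sqrt_eq_iff_eq_sq (by positivity) (by positivity), mul_pow, hss, ← hs3]; ring
  -- The divisor `3` makes `a² = s / 9`, so that `exp (a²)` stays below the `exp (s / 8)` of the
  -- packing bound.
  set a := √s / 3
  have ha : 1 / 3 ≤ a := by
    have : 1 ≤ √s := Real.one_le_sqrt.2 hs1
    simp only [a]; linarith
  have ha0 : 0 < a := by linarith
  have has : 9 * a ^ 2 = s := by simp only [a]; rw [div_pow, hss]; ring
  obtain ⟨S, hS, hlow, hupp, hov⟩ := exists_card_le_and_overlap_le hn hs0.le hs3 ha has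
  refine ⟨S, hS, fun σ hσ τ hτ hne => (hov σ hσ τ hτ hne).trans (by rw [hs2]; linarith), ?_⟩
  intro Ω _ P _ X hX hlaw
  set γ := Measure.pi fun _ : Fin n => gaussianReal 0 1
  set M := maxField (fun i (x : Fin n → ℝ) => x i) S hS
  have hMm : Measurable M := measurable_maxField hS
  have hMi : Integrable M γ := integrable_maxField hS
  have hbound : ∀ t, 0 ≤ t →
      γ.real {x | t ≤ |M x - √n * a|} ≤ 3 * Real.exp (-(c / s * t)) := by
    intro t ht
    refine (hconc γ M (√n * a) s hMm hs0
      ((satisfiesPrekopaLeindler_pi_gaussianReal n).measureReal_lt_mul_le_sq hMm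
        (maxField_midpoint_le hS)) ?_ ?_ t ht).trans (le_of_eq (by ring_nf))
    · intro t ht
      have hn0 : 0 < √(n : ℝ) := by positivity
      have h := measureReal_le_maxField_le hn hS ha0 hupp (t / √n)
      have e1 : √n * (a + t / √n) = √n * a + t := by field_simp
      have e2 : a * (t / √n) = t / (3 * s) := by
        rw [hsn]; simp only [a]; field_simp
      rwa [e1, e2] at h
    · refine hδ n hn S hS a ha hlow fun σ hσ τ hτ hne => ?_
      -- Here `n = s³`; since `a² + 1 = s / 9 + 1 ≤ 2 * s`, the correlations meet both requirements
      -- of the pair estimate.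
      have h1 : |(overlap σ τ : ℝ) / n| ≤ 1 / (2 * s) := by
        rw [abs_div, abs_of_pos (by linarith : (0 : ℝ) < n), ← hs3,
          div_le_div_iff₀ (by positivity) (by positivity)]
        nlinarith [hov σ hσ τ hτ hne]
      refine ⟨h1.trans ?_, ?_⟩
      · rw [div_le_div_iff₀ (by positivity) two_pos]; linarith
      · calc _ ≤ 1 / (2 * s) * (a ^ 2 + 1) := by gcongr
          _ ≤ 1 := by
            rw [one_div_mul_eq_div, div_le_one (by positivity)]
            nlinarith
  -- Integrability, mean and tails depend only on the joint law, so everything transfers from the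
  -- product Gaussian measure.
  have hXlaw : HasLaw (fun ω i => X i ω) γ P := hX.hasLaw_pi hlaw
  have hcomp : maxField X S hS = M ∘ fun ω i => X i ω := rfl
  have hmean : ∫ ω, maxField X S hS ω ∂P = ∫ x, M x ∂γ :=
    hXlaw.integral_comp hMm.aestronglyMeasurable
  refine ⟨?_, fun t ht => ?_⟩
  · rw [hcomp]
    refine Integrable.comp_aemeasurable ?_ hXlaw.aemeasurable
    rwa [hXlaw.map_eq]
  · rw [hmean]
    have h := hXlaw.measureReal_eq (p := fun x => t ≤ |M x - ∫ y, M y ∂γ|)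
      (measurableSet_le measurable_const (by fun_prop))
    refine h.trans_le ((measureReal_le_abs_sub_integral_le hMi (by positivity) hbound).trans
      (le_of_eq ?_))
    ring_nf
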